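/- Let $G$ be an arbitrary group and let $H$ be a hyperbolic group, i.e. a group with a finite generating set whose word metric is $\delta$-hyperbolic in the sense of Gromov for some $\delta$. Equip the discrete group $H$ with any proper left-invariant metric $d$ (for example a word metric of a finite generating set). A map $f\colon G\to H$ is a quasihomomorphism if there is a constant $C$ with $d(f(xy),f(x)f(y))\le C$ for all $x,y\in G$; it is unbounded if its image is an unbounded (equivalently, infinite) subset of $H$. A quasimorphism is a map $q\colon G\to\mathbb Z$ for which $|q(xy)-q(x)-q(y)|$ is bounded uniformly in $x,y\in G$. Let $f\colon G\to H$ be an unbounded quasihomomorphism. 1. If $H$ is torsion-free, then either $f$ is a homomorphism, or $f$ is a quasimorphism to an infinite cyclic subgroup of $H$; that is, there are a subgroup $C\le H$, an isomorphism $e\colon\mathbb Z\to C$ and a quasimorphism $q\colon G\to\mathbb Z$ with $f(x)=e(q(x))$ for all $x\in G$. 2. For general hyperbolic $H$, either the image of $f$ is contained in an elementary (i.e. virtually cyclic) subgroup of $H$, or $f$ is an almost homomorphism; that is, there are a subgroup $J\le H$ with $f(G)\subseteq J$ and a finite normal subgroup $K$ of $J$ such that the composition of $f$ with the projection $J\to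 J/K$ is a homomorphism. -/

import Mathlib

/-- A map `f : G → H` into a group with a (left-invariant) metric is a quasihomomorphism if
`d (f (x y), f x f y)` is bounded uniformly in `x` and `y`. -/
def IsQuasihomomorphism {G H : Type*} [Group G] [Group H] [MetricSpace H] (f : G → H) : Prop :=
  ∃ C : ℝ, ∀ x y : G, dist (f (x * y)) (f x * f y) ≤ C

/-- A quasimorphism: a quasihomomorphism with values in the integers with their usual metric. -/
def IsQuasimorphism {G : Type*} [Group G] (q : G → ℤ) : Prop :=
  ∃ C : ℝ, ∀ x y : G, dist (q (x * y)) (q x + q y) ≤ C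

/-- `f` is a homomorphism modulo a finite normal subgroup: its image lies in a subgroup `J` with a
finite normal subgroup `K`, and the projection of `f` to `J ⧸ K` is a homomorphism. -/
def IsAlmostHomomorphism {G H : Type*} [Group G] [Group H] (f : G → H) : Prop :=
  ∃ (J : Subgroup H) (K : Subgroup J) (_ : K.Normal) (hJ : ∀ x, f x ∈ J) (φ : G →* J ⧸ K),
    Finite K ∧ ∀ x, φ x = QuotientGroup.mk (⟨f x, hJ x⟩ : J)

/-- Word length with respect to `S`: the least length of a word in elements of `S` and their
inverses that represents `h`. -/
noncomputable def wordLength {H : Type*} [Group H] (S : Set H) (h : H) : ℕ :=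
  sInf {n | ∃ l : List H, l.length = n ∧ (∀ a ∈ l, a ∈ S ∨ a⁻¹ ∈ S) ∧ l.prod = h}

/-- The left-invariant word metric of `S`. -/
noncomputable def wordDist {H : Type*} [Group H] (S : Set H) (g h : H) : ℝ :=
  wordLength S (g⁻¹ * h)

/-- The Gromov product of `x` and `y` based at `w`, in the word metric of `S`. -/
noncomputable def gromovProduct {H : Type*} [Group H] (S : Set H) (w x y : H) : ℝ :=
  (wordDist S w x + wordDist S w y - wordDist S x y) / 2

/-- A (Gromov) hyperbolic group: a group with a finite generating set whose word metric is
`δ`-hyperbolic, in the sense of Gromov products, for some `δ`. -/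
def IsHyperbolicGroup (H : Type*) [Group H] : Prop :=
  ∃ S : Set H, S.Finite ∧ Subgroup.closure S = ⊤ ∧ ∃ δ : ℝ, ∀ w x y z : H,
    min (gromovProduct S w x y) (gromovProduct S w y z) - δ ≤ gromovProduct S w x z

/-- Elementary subgroups (of hyperbolic groups) are the virtually cyclic ones, finite ones included:
those that have a cyclic subgroup of finite index. -/
def IsElementarySubgroup {H : Type*} [Group H] (E : Subgroup H) : Prop :=
  ∃ Z : Subgroup E, IsCyclic Z ∧ Z.FiniteIndex

/-!
Let `D` be the set of defects `(f (x * y))⁻¹ * (f x * f y)`, which is finite because balls of a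
proper discrete metric are finite, and let `Δ` be the group it generates. Bracketing
`f x * f y * f z` in two ways shows that `f z` conjugates `D` into the fixed finite set
`D⁻¹ * D * D` (`conj_defect`). Hence `f` takes values in the normalizer of `Δ`, it is a homomorphism
modulo `Δ` (`quotientHom`), and its values lie in finitely many right cosets of the centralizer of
`Δ` (`exists_finite_right_cosets`). If `Δ` is finite, then `f` is an almost homomorphism, and a
homomorphism if `H` has no torsion, since then `Δ` is trivial.

If `Δ` is infinite, then `Δ` and its centralizer are commuting infinite subgroups, the latter because
`f` is unbounded. Here hyperbolicity enters. Let `A` be a group that centralizes an infinite set `C`,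
and let `h ∈ C` tend to infinity along an ultrafilter. The limit of `d(1, h) - d(g, h)` is a
quasimorphism `β` on `A` by the four-point inequality, as `d(h, g * h) = d(h, h * g)` stays bounded.
If `|β g| ≤ T`, then `g` moves points that lie far from both ends of a geodesic from `1` to `h` by
at most `T + 6 * δ` (`wordLength_conj_le`), so the level sets of `β` are finite
(`exists_isProperQuasimorphism`). A group with such a quasimorphism has an element of infinite order
if it is infinite, and every element of infinite order generates a subgroup of finite index.

Applied to `Δ` and to the centralizer of an element `g ∈ Δ` of infinite order, this shows that `⟨g⟩`
has finite index in the group generated by `Δ` and the values of `f`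
(`exists_finiteIndex_zpowers_imageGroup`), which is thus elementary. If `H` has no torsion, this
group is infinite cyclic (`isCyclic_of_finiteIndex_zpowers`), by an argument with the transfer to the
center, and `f` has finitely many defects in it, so that it is a quasimorphism to `ℤ`.
-/

/-! ### Word length -/

section WordLength

variable {H : Type*} [Group H] {S : Set H}

theorem exists_list_length_eq_wordLength (hS : Subgroup.closure S = ⊤) (h : H) :
    ∃ l : List H, l.length = wordLength S h ∧ (∀ a ∈ l, a ∈ S ∨ a⁻¹ ∈ S) ∧ l.prod = h := by
  have hne : {n | ∃ l : List H, l.length = n ∧ (∀ a ∈ l, a ∈ S ∨ a⁻¹ ∈ S) ∧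
      l.prod = h}.Nonempty := by
    have hh : h ∈ Submonoid.closure (S ∪ S⁻¹) := by
      rw [← Subgroup.closure_toSubmonoid, hS]
      trivial
    obtain ⟨l, hl, hp⟩ := Submonoid.exists_list_of_mem_closure hh
    exact ⟨_, l, rfl, hl, hp⟩
  exact Nat.sInf_mem hne

theorem wordLength_prod_le {l : List H} (hl : ∀ a ∈ l, a ∈ S ∨ a⁻¹ ∈ S) :
    wordLength S l.prod ≤ l.length :=
  Nat.sInf_le ⟨l, rfl, hl, rfl⟩

theorem wordLength_mul_le (hS : Subgroup.closure S = ⊤) (a b : H) :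
    wordLength S (a * b) ≤ wordLength S a + wordLength S b := by
  obtain ⟨l, hl, hl', rfl⟩ := exists_list_length_eq_wordLength hS a
  obtain ⟨m, hm, hm', rfl⟩ := exists_list_length_eq_wordLength hS b
  rw [← hl, ← hm, ← List.length_append, ← List.prod_append]
  exact wordLength_prod_le fun a ha ↦ (List.mem_append.mp ha).elim (hl' a) (hm' a)

theorem wordLength_inv_le (hS : Subgroup.closure S = ⊤) (a : H) :
    wordLength S a⁻¹ ≤ wordLength S a := by
  obtain ⟨l, hl, hl', rfl⟩ := exists_list_length_eq_wordLength hS a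
  rw [← hl, List.prod_inv_reverse]
  refine (wordLength_prod_le fun x hx ↦ ?_).trans (by simp)
  simp only [List.mem_reverse, List.mem_map] at hx
  obtain ⟨y, hy, rfl⟩ := hx
  simpa [or_comm] using hl' y hy

theorem wordLength_inv (hS : Subgroup.closure S = ⊤) (a : H) :
    wordLength S a⁻¹ = wordLength S a :=
  (wordLength_inv_le hS a).antisymm (by simpa using wordLength_inv_le hS a⁻¹)

/-- A word metric is geodesic at integer times: cut a shortest word after `m` letters. -/
theorem exists_wordLength_eq (hS : Subgroup.closure S = ⊤) (h : H) {m : ℕ}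
    (hm : m ≤ wordLength S h) :
    ∃ p : H, wordLength S p = m ∧ wordLength S (p⁻¹ * h) + m = wordLength S h := by
  obtain ⟨l, hl, hl', rfl⟩ := exists_list_length_eq_wordLength hS h
  have h1 : wordLength S (l.take m).prod ≤ m :=
    (wordLength_prod_le fun a ha ↦ hl' a (List.mem_of_mem_take ha)).trans (by simp)
  have h2 : wordLength S (l.drop m).prod ≤ wordLength S l.prod - m :=
    (wordLength_prod_le fun a ha ↦ hl' a (List.mem_of_mem_drop ha)).trans (by simp [hl])
  have h3 : (l.take m).prod * (l.drop m).prod = l.prod := List.prod_take_mul_prod_drop l m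
  have h4 : wordLength S l.prod ≤ _ := h3 ▸ wordLength_mul_le hS _ _
  refine ⟨(l.take m).prod, ?_, ?_⟩
  · omega
  · rw [← h3, inv_mul_cancel_left, h3]
    omega

theorem finite_setOf_wordLength_le (hS : Subgroup.closure S = ⊤) (hfin : S.Finite) (n : ℕ) :
    {h : H | wordLength S h ≤ n}.Finite := by
  have hT : (S ∪ S⁻¹).Finite := hfin.union hfin.inv
  have hlist : {l : List H | l.length ≤ n ∧ ∀ a ∈ l, a ∈ S ∪ S⁻¹}.Finite := by
    have := hT.to_subtype
    refine ((List.finite_length_le (S ∪ S⁻¹ : Set H) n).image (List.map Subtype.val)).subset ?_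
    rintro l ⟨hl, hl'⟩
    lift l to List (S ∪ S⁻¹ : Set H) using hl'
    exact ⟨l, by simpa using hl, rfl⟩
  refine (hlist.image List.prod).subset fun h hh ↦ ?_
  obtain ⟨l, hl, hl', rfl⟩ := exists_list_length_eq_wordLength hS h
  exact ⟨l, ⟨hl.trans_le hh, hl'⟩, rfl⟩

theorem wordDist_comm (hS : Subgroup.closure S = ⊤) (a b : H) :
    wordDist S a b = wordDist S b a := by
  rw [wordDist, wordDist, ← wordLength_inv hS, mul_inv_rev, inv_inv]

theorem wordDist_triangle (hS : Subgroup.closure S = ⊤) (a b c : H) :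
    wordDist S a c ≤ wordDist S a b + wordDist S b c := by
  have := wordLength_mul_le hS (a⁻¹ * b) (b⁻¹ * c)
  rw [mul_assoc, mul_inv_cancel_left] at this
  unfold wordDist
  exact_mod_cast this

theorem wordDist_mul_left (a b c : H) : wordDist S (a * b) (a * c) = wordDist S b c := by
  simp [wordDist, mul_assoc]

theorem wordDist_one_left (a : H) : wordDist S 1 a = wordLength S a := by
  simp [wordDist]

end WordLength

/-! ### Quasimorphisms with finite level sets -/

/-- A real quasimorphism of defect at most `D` that is proper on a discrete group: only finitely
many elements have values in a given bounded set. -/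
structure IsProperQuasimorphism {K : Type*} [Group K] (β : K → ℝ) (D : ℝ) : Prop where
  defect : ∀ x y, |β (x * y) - β x - β y| ≤ D
  finite : ∀ T : ℝ, {x | |β x| ≤ T}.Finite

namespace IsProperQuasimorphism

variable {K : Type*} [Group K] {β : K → ℝ} {D : ℝ}

theorem abs_add_inv_le (h : IsProperQuasimorphism β D) (g : K) : |β g + β g⁻¹| ≤ 2 * D := by
  have h1 := abs_le.mp (h.defect 1 1)
  have h2 := abs_le.mp (h.defect g g⁻¹)
  rw [mul_one] at h1
  rw [mul_inv_cancel] at h2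
  exact abs_le.mpr ⟨by linarith, by linarith⟩

theorem step (h : IsProperQuasimorphism β D) (x g : K) (n : ℤ) :
    β (x * g ^ n) + (β g - D) ≤ β (x * g ^ (n + 1)) ∧
      β (x * g ^ (n + 1)) ≤ β (x * g ^ n) + (β g + D) := by
  have := abs_le.mp (h.defect (x * g ^ n) g)
  rw [mul_assoc, ← zpow_add_one] at this
  constructor <;> linarith

theorem not_isOfFinOrder_of_lt (h : IsProperQuasimorphism β D) {g : K} (hg : D < β g) :
    ¬IsOfFinOrder g := by
  rw [← injective_zpow_iff_not_isOfFinOrder]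
  have hmono : StrictMono fun n : ℤ ↦ β (1 * g ^ n) :=
    strictMono_int_of_lt_succ fun n ↦ by linarith [(h.step 1 g n).1]
  intro m n hmn
  exact hmono.injective (congrArg (fun y ↦ β (1 * y)) hmn)

theorem add_nat_mul_le (h : IsProperQuasimorphism β D) (x g : K) (n : ℤ) (k : ℕ) :
    β (x * g ^ n) + k * (β g - D) ≤ β (x * g ^ (n + k)) := by
  induction k with
  | zero => simp
  | succ k ih =>
    have := (h.step x g (n + k)).1
    push_cast
    rw [← add_assoc]
    linarith

/-- Along a coset `x⟨g⟩` the values grow with steps between `β g - D > 0` and `β g + D`, so the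
coset meets the finite level set `|β| ≤ β g + D`. -/
theorem exists_finite_of_lt (h : IsProperQuasimorphism β D) {g : K} (hg : D < β g) :
    ∃ F : Set K, F.Finite ∧ ∀ x, ∃ s ∈ F, s⁻¹ * x ∈ Subgroup.zpowers g := by
  refine ⟨_, h.finite (β g + D), fun x ↦ ?_⟩
  have hε : 0 < β g - D := by linarith
  obtain ⟨k, hk⟩ := exists_nat_gt (|β x| / (β g - D))
  rw [div_lt_iff₀ hε] at hk
  have hx := abs_le.mp (le_refl |β x|)
  obtain ⟨n, hn, hmax⟩ := Int.exists_greatest_of_bdd (P := fun n : ℤ ↦ β (x * g ^ n) ≤ 0)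
    ⟨k, fun z hz ↦ by
      by_contra! hlt
      have h1 := h.add_nat_mul_le x g 0 z.toNat
      have h2 : (k : ℝ) ≤ z.toNat := by exact_mod_cast (by omega : k ≤ z.toNat)
      rw [zero_add, Int.toNat_of_nonneg (by omega), zpow_zero, mul_one] at h1
      nlinarith [mul_le_mul_of_nonneg_right h2 hε.le]⟩
    ⟨-k, by
      have h1 := h.add_nat_mul_le x g (-k) k
      rw [neg_add_cancel, zpow_zero, mul_one] at h1
      linarith⟩
  have hpos : 0 < β (x * g ^ (n + 1)) := by
    by_contra! hle
    have := hmax _ hle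
    omega
  have hD : 0 ≤ D := (abs_nonneg _).trans (h.defect 1 1)
  have hlevel : |β (x * g ^ n)| ≤ β g + D :=
    abs_le.mpr ⟨by linarith [(h.step x g n).2], by linarith⟩
  exact ⟨x * g ^ n, hlevel, Subgroup.mem_zpowers_iff.mpr ⟨-n, by group⟩⟩

theorem exists_not_isOfFinOrder [Infinite K] (h : IsProperQuasimorphism β D) :
    ∃ g : K, ¬IsOfFinOrder g := by
  obtain ⟨g, hg⟩ := (h.finite (3 * D)).infinite_compl.nonempty
  simp only [Set.mem_compl_iff, Set.mem_ofPred_eq, not_le] at hg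
  have hinv := abs_le.mp (h.abs_add_inv_le g)
  rcases lt_abs.mp hg with hg | hg
  · exact ⟨g, h.not_isOfFinOrder_of_lt (by linarith [(abs_nonneg _).trans (h.defect 1 1)])⟩
  · exact ⟨g⁻¹, h.not_isOfFinOrder_of_lt (by linarith)⟩

theorem exists_finite (h : IsProperQuasimorphism β D) {g : K} (hg : ¬IsOfFinOrder g) :
    ∃ F : Set K, F.Finite ∧ ∀ x, ∃ s ∈ F, s⁻¹ * x ∈ Subgroup.zpowers g := by
  -- some power of `g` has a large value, since the powers of `g` are distinct
  have hinj := injective_zpow_iff_not_isOfFinOrder.mpr hg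
  obtain ⟨n, hn⟩ := ((h.finite (3 * D)).preimage hinj.injOn).infinite_compl.nonempty
  simp only [Set.mem_compl_iff, Set.mem_preimage, Set.mem_ofPred_eq, not_le] at hn
  have hinv := abs_le.mp (h.abs_add_inv_le (g ^ n))
  have hD : 0 ≤ D := (abs_nonneg _).trans (h.defect 1 1)
  obtain ⟨k, hk⟩ : ∃ k : ℤ, D < β (g ^ k) := by
    rcases lt_abs.mp hn with hn | hn
    · exact ⟨n, by linarith⟩
    · exact ⟨-n, by rw [zpow_neg]; linarith⟩
  obtain ⟨F, hF, hcov⟩ := h.exists_finite_of_lt hk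
  refine ⟨F, hF, fun x ↦ ?_⟩
  obtain ⟨s, hs, hx⟩ := hcov x
  exact ⟨s, hs, Subgroup.zpowers_le.mpr (Subgroup.zpow_mem_zpowers g k) hx⟩

end IsProperQuasimorphism

/-! ### The Busemann quasimorphism of a centralizer -/

section Busemann

variable {H : Type*} [Group H] {S : Set H} {δ : ℝ}

/-- The four-point form of Gromov's inequality: the two largest of the three sums of opposite sides
differ by at most `2 * δ`. -/
def FourPoint (S : Set H) (δ : ℝ) : Prop :=
  ∀ w x y z : H, wordDist S x z + wordDist S w y ≤
    max (wordDist S x y + wordDist S w z) (wordDist S y z + wordDist S w x) + 2 * δ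

theorem fourPoint_of_gromovProduct (h : ∀ w x y z : H,
    min (gromovProduct S w x y) (gromovProduct S w y z) - δ ≤ gromovProduct S w x z) :
    FourPoint S δ := by
  intro w x y z
  have := h w x y z
  simp only [gromovProduct] at this
  rcases min_le_iff.mp (sub_le_iff_le_add.mp this) with h | h
  · linarith [le_max_left (wordDist S x y + wordDist S w z) (wordDist S y z + wordDist S w x)]
  · linarith [le_max_right (wordDist S x y + wordDist S w z) (wordDist S y z + wordDist S w x)]

theorem FourPoint.nonneg (h : FourPoint S δ) : 0 ≤ δ := by
  have := h 1 1 1 1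
  rw [max_self] at this
  linarith

/-- If `g` commutes with a long element `h`, it translates a geodesic from `1` to `h` to a nearby
geodesic; a point `p` of the geodesic that is far from both ends is moved by about the shift `b`. -/
theorem wordLength_conj_le (hS : Subgroup.closure S = ⊤) (h4 : FourPoint S δ) {g h p : H} {b : ℝ}
    (hgh : g * h = h * g) (hb : wordDist S 1 h - wordDist S g h = b)
    (hp : wordLength S g ≤ wordLength S p)
    (hph : wordLength S (p⁻¹ * h) + wordLength S p = wordLength S h)
    (hle : 2 * wordLength S p ≤ wordLength S h) :
    (wordLength S (p⁻¹ * (g * p)) : ℝ) ≤ |b| + 6 * δ := by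
  have hδ := h4.nonneg
  have c := wordDist_comm hS
  have e1 : wordDist S 1 h = wordLength S h := wordDist_one_left h
  have e2 : wordDist S 1 g = wordLength S g := wordDist_one_left g
  have e3 : wordDist S 1 p = wordLength S p := wordDist_one_left p
  have e4 : wordDist S g (g * h) = wordLength S h := by
    simpa [e1] using wordDist_mul_left (S := S) g 1 h
  have e5 : wordDist S g (g * p) = wordLength S p := by
    simpa [e3] using wordDist_mul_left (S := S) g 1 p
  have e6 : wordDist S h (g * h) = wordLength S g := by
    rw [hgh]
    simpa [e2] using wordDist_mul_left (S := S) h 1 g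
  have e7 : wordDist S p h = wordLength S h - wordLength S p := by
    rw [wordDist, ← hph]
    simp
  have e8 : wordDist S (g * p) (g * h) = wordLength S h - wordLength S p := by
    rw [wordDist_mul_left, e7]
  have hp' : (wordLength S g : ℝ) ≤ wordLength S p := by exact_mod_cast hp
  have hle' : 2 * (wordLength S p : ℝ) ≤ wordLength S h := by exact_mod_cast hle
  have hb1 : |b| ≤ wordLength S g := by
    have t1 := wordDist_triangle hS 1 g h
    have t2 := wordDist_triangle hS g 1 h
    rw [c g 1] at t2
    exact abs_le.mpr ⟨by linarith, by linarith⟩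
  have hb2 := abs_le.mp hb1
  have q1 : wordDist S 1 (g * h) ≤ wordLength S h + b + 2 * δ := by
    have := h4 g 1 h (g * h)
    rw [e1, e4, e6, c g 1, e2] at this
    have hm := max_le_iff.mpr ⟨(by linarith : (wordLength S h : ℝ) + wordLength S h ≤
      2 * wordLength S h), (by linarith : (wordLength S g : ℝ) + wordLength S g ≤
      2 * wordLength S h)⟩
    linarith
  have q2 : wordDist S (g * p) h ≤ wordLength S h - wordLength S p - b + 2 * δ := by
    have := h4 g (g * p) (g * h) h
    rw [e4, e5, e8, c (g * h) h, e6] at this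
    have hm := max_le_iff.mpr ⟨(by linarith : (wordLength S h : ℝ) - wordLength S p +
      wordDist S g h ≤ 2 * wordLength S h - wordLength S p - b), (by linarith :
      (wordLength S g : ℝ) + wordLength S p ≤ 2 * wordLength S h - wordLength S p - b)⟩
    linarith
  have q3 : wordDist S 1 (g * p) ≤ wordLength S p + b + 4 * δ := by
    have := h4 g 1 (g * h) (g * p)
    rw [e4, e5, c (g * h), e8, c g 1, e2] at this
    have hm := max_le_iff.mpr ⟨(by linarith : wordDist S 1 (g * h) + wordLength S p ≤
      wordLength S h + wordLength S p + b + 2 * δ), (by linarith :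
      (wordLength S h : ℝ) - wordLength S p + wordLength S g ≤
      wordLength S h + wordLength S p + b + 2 * δ)⟩
    linarith
  have q4 := h4 1 p h (g * p)
  rw [e1, c h, e3, e7] at q4
  have hm := max_le_iff.mpr ⟨(by linarith [le_abs_self b] : (wordLength S h : ℝ) -
    wordLength S p + wordDist S 1 (g * p) ≤ wordLength S h + |b| + 4 * δ),
    (by linarith [neg_abs_le b] : wordDist S (g * p) h + wordLength S p ≤
    wordLength S h + |b| + 4 * δ)⟩
  have : wordDist S p (g * p) ≤ |b| + 6 * δ := by linarith
  exact this

/-- The ultralimit of `d(1, h) - d(g, h)` exists along every ultrafilter, because these differences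
take finitely many values. -/
theorem exists_eventually_busemann_eq (hS : Subgroup.closure S = ⊤) (μ : Ultrafilter H) (g : H) :
    ∃ b : ℝ, ∀ᶠ h in μ, wordDist S 1 h - wordDist S g h = b := by
  have hfin : ((fun n : ℤ ↦ (n : ℝ)) '' Set.Icc (-wordLength S g : ℤ) (wordLength S g)).Finite :=
    (Set.finite_Icc _ _).image _
  have hex : ∀ᶠ h in (μ : Filter H), ∃ b ∈ ((fun n : ℤ ↦ (n : ℝ)) ''
      Set.Icc (-wordLength S g : ℤ) (wordLength S g)),
        wordDist S 1 h - wordDist S g h = b := by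
    refine Filter.Eventually.of_forall fun h ↦
      ⟨_, ⟨(wordLength S (1⁻¹ * h) : ℤ) - wordLength S (g⁻¹ * h), ?_, rfl⟩, by simp [wordDist]⟩
    have h1 := wordLength_mul_le hS g (g⁻¹ * h)
    have h2 := wordLength_mul_le hS g⁻¹ h
    rw [mul_inv_cancel_left] at h1
    rw [wordLength_inv hS] at h2
    rw [inv_one, one_mul, Set.mem_Icc]
    omega
  obtain ⟨b, -, hb⟩ := (Ultrafilter.eventually_exists_mem_iff hfin).mp hex
  exact ⟨b, hb⟩

/-- The horofunction of a point at infinity in the limit set of `C`, restricted to a group `A` that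
centralizes `C`. As `A` moves the elements of `C` by a bounded amount, it fixes this point, and the
horofunction is a quasimorphism on `A`. Its level sets are finite, because finitely many elements
with small shift can be conjugated simultaneously into a fixed ball. -/
theorem exists_isProperQuasimorphism (hS : Subgroup.closure S = ⊤) (hfin : S.Finite)
    (h4 : FourPoint S δ) {C : Set H} (hC : C.Infinite) {A : Subgroup H}
    (hA : A ≤ Subgroup.centralizer C) :
    ∃ β : A → ℝ, IsProperQuasimorphism β (2 * δ) := by
  have := hC.cofinite_inf_principal_neBot
  let μ := Ultrafilter.of (Filter.cofinite ⊓ Filter.principal C)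
  have hμ : (μ : Filter H) ≤ Filter.cofinite ⊓ Filter.principal C := Ultrafilter.of_le _
  have hμC : ∀ᶠ h in (μ : Filter H), h ∈ C := hμ (Filter.mem_inf_of_right (by simp))
  have hμl (n : ℕ) : ∀ᶠ h in (μ : Filter H), n ≤ wordLength S h := by
    refine hμ (Filter.mem_inf_of_left ?_)
    refine Filter.mem_of_superset (finite_setOf_wordLength_le hS hfin n).compl_mem_cofinite ?_
    intro h hh
    simp only [Set.mem_compl_iff, Set.mem_ofPred_eq, not_le] at hh
    exact hh.le
  choose β hβ using exists_eventually_busemann_eq hS μ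
  refine ⟨fun g ↦ β g, ?_, fun T ↦ ?_⟩
  · rintro ⟨a, ha⟩ ⟨b, hb⟩
    obtain ⟨h, hh, ha', hb', hab', hl⟩ :=
      (hμC.and ((hβ a).and ((hβ b).and ((hβ (a * b)).and
        (hμl (wordLength S a + wordLength S b)))))).exists
    have hc : h * a = a * h := hA ha h hh
    -- compare the horofunction at `h` and at `k`, at bounded distance from `h`
    set k := a⁻¹ * h with hk
    have hk' : h * a⁻¹ = k := by rw [hk, eq_inv_mul_iff_mul_eq, ← mul_assoc, ← hc]; group
    have e1 : wordDist S a h = wordDist S 1 k := by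
      simpa using (wordDist_mul_left (S := S) a⁻¹ a h).symm
    have e2 : wordDist S (a * b) h = wordDist S b k := by
      simpa using (wordDist_mul_left (S := S) a⁻¹ (a * b) h).symm
    have e3 : wordDist S h k = wordLength S a := by
      rw [← hk']
      simp [wordDist, wordLength_inv hS]
    have e4 : wordDist S 1 b = wordLength S b := wordDist_one_left b
    have e5 : wordDist S 1 h = wordLength S h := wordDist_one_left h
    have hl' : (wordLength S a : ℝ) + wordLength S b ≤ wordLength S h := by exact_mod_cast hl
    have c := wordDist_comm hS
    have t1 := wordDist_triangle hS 1 k h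
    have t2 := wordDist_triangle hS 1 b h
    have p1 : 0 ≤ wordDist S b k := Nat.cast_nonneg _
    have q1 := h4 1 k h b
    have q2 := h4 1 h k b
    rw [c k h] at q1 t1
    rw [c k b] at q2
    rw [c k b, c h b] at q1
    rw [c h b] at q2
    have m1 := max_le_iff.mpr ⟨(by linarith : wordDist S h k + wordDist S 1 b ≤
      wordDist S b h + wordDist S 1 k), le_refl _⟩
    have m2 := max_le_iff.mpr ⟨(by linarith : wordDist S h k + wordDist S 1 b ≤
      wordDist S b k + wordDist S 1 h), le_refl _⟩
    rw [e1] at ha'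
    rw [e2] at hab'
    simp only [Subgroup.coe_mul]
    exact abs_le.mpr ⟨by linarith, by linarith⟩
  · have hball := finite_setOf_wordLength_le hS hfin ⌊T + 6 * δ⌋₊
    by_contra hinf
    obtain ⟨s, hs, hcard⟩ := Set.Infinite.exists_subset_card_eq hinf (hball.toFinset.card + 1)
    let m := s.sup fun g ↦ wordLength S (g : H)
    obtain ⟨h, hh, hl, hs'⟩ := (hμC.and ((hμl (2 * m)).and
      ((Filter.eventually_all_finset s).mpr fun g _ ↦ hβ (g : H)))).exists
    obtain ⟨p, hpm, hp⟩ := exists_wordLength_eq hS h (m := m) (by omega)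
    have := Finset.card_le_card_of_injOn (s := s) (t := hball.toFinset)
      (fun g ↦ p⁻¹ * (g * p)) (fun g hg ↦ ?_) fun x _ y _ hxy ↦ by simpa using hxy
    · omega
    · have hgT : |β g| ≤ T := hs hg
      simp only [Set.Finite.coe_toFinset, Set.mem_ofPred_eq]
      refine Nat.le_floor ?_
      refine (wordLength_conj_le hS h4 (hA g.2 h hh).symm (hs' g hg) ?_ (hpm ▸ hp)
        (hpm ▸ hl)).trans (by linarith)
      rw [hpm]
      exact Finset.le_sup (f := fun g : A ↦ wordLength S (g : H)) hg

end Busemann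

/-! ### Finite index via finite covers -/

section Cover

variable {H : Type*} [Group H]

theorem finiteIndex_subgroupOf_of_cover {Z E : Subgroup H} {F : Set H} (hF : F.Finite)
    (hcov : ∀ a ∈ E, ∃ s ∈ F, s⁻¹ * a ∈ Z) : (Z.subgroupOf E).FiniteIndex := by
  have := hF.to_subtype
  choose s hsF hs using fun a : E ↦ hcov a a.2
  have : Finite (E ⧸ Z.subgroupOf E) := by
    refine Finite.of_injective (fun q ↦ (⟨s q.out, hsF _⟩ : F)) fun p q hpq ↦ ?_
    have heq : s p.out = s q.out := congrArg Subtype.val hpq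
    rw [← p.out_eq', ← q.out_eq', QuotientGroup.eq, Subgroup.mem_subgroupOf]
    have := mul_mem (inv_mem (hs p.out)) (hs q.out)
    rw [heq] at this
    simpa [mul_assoc] using this
  exact Subgroup.finiteIndex_of_finite_quotient

theorem finiteIndex_zpowers_zpow {g : H} (hg : (Subgroup.zpowers g).FiniteIndex) {N : ℤ}
    (hN : N ≠ 0) : (Subgroup.zpowers (g ^ N)).FiniteIndex := by
  have h1 : (Subgroup.zpowers (g ^ N)).relIndex (Subgroup.zpowers g) ≠ 0 := by
    refine (finiteIndex_subgroupOf_of_cover (F := (fun i : ℤ ↦ g ^ i) '' Set.Ico 0 |N|)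
      ((Set.finite_Ico _ _).image _) ?_).index_ne_zero
    rintro _ ⟨n, rfl⟩
    refine ⟨_, ⟨n % N, ⟨Int.emod_nonneg n hN, Int.emod_lt_abs n hN⟩, rfl⟩, n / N, ?_⟩
    have h := Int.mul_ediv_add_emod n N
    change (g ^ N) ^ (n / N) = (g ^ (n % N))⁻¹ * g ^ n
    rw [← zpow_mul, ← zpow_neg, ← zpow_add]
    congr 1
    omega
  have hle : Subgroup.zpowers (g ^ N) ≤ Subgroup.zpowers g :=
    Subgroup.zpowers_le.mpr (Subgroup.zpow_mem_zpowers g N)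
  rw [Subgroup.finiteIndex_iff, ← Subgroup.relIndex_mul_index hle]
  exact mul_ne_zero h1 hg.index_ne_zero

end Cover

/-! ### Torsion-free virtually cyclic groups -/

section TorsionFree

variable {K : Type*} [Group K]

theorem eq_one_of_pow_eq_one_of_torsionFree (htf : ∀ k : K, IsOfFinOrder k → k = 1) {n : ℕ}
    (hn : n ≠ 0) {k : K} (hk : k ^ n = 1) : k = 1 :=
  htf k (isOfFinOrder_iff_pow_eq_one.mpr ⟨n, Nat.pos_of_ne_zero hn, hk⟩)

/-- The transfer to the center is a power map, hence injective, so `K` embeds in its center. -/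
theorem commute_of_finiteIndex_center (htf : ∀ k : K, IsOfFinOrder k → k = 1)
    [(Subgroup.center K).FiniteIndex] (x y : K) : x * y = y * x := by
  have hinj : Function.Injective (MonoidHom.transferCenterPow K) := by
    refine (injective_iff_map_eq_one _).mpr fun k hk ↦ ?_
    refine eq_one_of_pow_eq_one_of_torsionFree htf (Subgroup.FiniteIndex.index_ne_zero
      (H := Subgroup.center K)) ?_
    rw [← MonoidHom.transferCenterPow_apply, hk, Subgroup.coe_one]
  refine hinj ?_
  rw [map_mul, map_mul]
  exact Subtype.ext (Subgroup.mem_center_iff.mp (MonoidHom.transferCenterPow K y).2 _)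

/-- Two elements have powers in `⟨g⟩`, so both commute with a common nontrivial power of `g`, and
the centralizer of this power has a center of finite index. -/
theorem commute_of_finiteIndex_zpowers (htf : ∀ k : K, IsOfFinOrder k → k = 1) {g : K}
    (hg : (Subgroup.zpowers g).FiniteIndex) (x y : K) : x * y = y * x := by
  rcases eq_or_ne x 1 with rfl | hx
  · simp
  rcases eq_or_ne y 1 with rfl | hy
  · simp
  have key (k : K) (hk : k ≠ 1) : ∃ l : ℤ, l ≠ 0 ∧ Commute (g ^ l) k := by
    obtain ⟨n, hn, -, l, hl⟩ := Subgroup.exists_pow_mem_of_index_ne_zero hg.index_ne_zero k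
    have hl : g ^ l = k ^ n := hl
    refine ⟨l, ?_, hl ▸ Commute.pow_self k n⟩
    rintro rfl
    exact hk (eq_one_of_pow_eq_one_of_torsionFree htf hn.ne' (by rw [← hl, zpow_zero]))
  obtain ⟨l, hl, hlx⟩ := key x hx
  obtain ⟨m, hm, hmy⟩ := key y hy
  set z := g ^ (l * m) with hz
  have hzx : Commute z x := by rw [hz, zpow_mul]; exact hlx.zpow_left m
  have hzy : Commute z y := by rw [hz, mul_comm, zpow_mul]; exact hmy.zpow_left l
  have hzfi : (Subgroup.zpowers z).FiniteIndex := finiteIndex_zpowers_zpow hg (mul_ne_zero hl hm)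
  let A := Subgroup.centralizer {z}
  have hmemA {k : K} (hk : Commute z k) : k ∈ A := by
    rintro _ rfl
    exact hk
  have hle : (Subgroup.zpowers z).subgroupOf A ≤ Subgroup.center A := by
    rintro ⟨a, ha⟩ ⟨n, hn : z ^ n = a⟩
    rw [Subgroup.mem_center_iff]
    rintro ⟨b, hb⟩
    have hb : Commute z b := hb z rfl
    ext
    subst hn
    exact (hb.zpow_left n).symm
  have : (Subgroup.center A).FiniteIndex := Subgroup.finiteIndex_of_le hle
  have htfA : ∀ k : A, IsOfFinOrder k → k = 1 := fun k hk ↦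
    Subtype.ext (htf k (Submonoid.isOfFinOrder_coe.mpr hk))
  exact congrArg Subtype.val
    (commute_of_finiteIndex_center htfA ⟨x, hmemA hzx⟩ ⟨y, hmemA hzy⟩)

theorem isCyclic_of_finiteIndex_zpowers (htf : ∀ k : K, IsOfFinOrder k → k = 1) {g : K}
    (hg : (Subgroup.zpowers g).FiniteIndex) : IsCyclic K := by
  let _ : CommGroup K :=
    { (inferInstance : Group K) with mul_comm := commute_of_finiteIndex_zpowers htf hg }
  let φ : K →* Subgroup.zpowers g :=
    (powMonoidHom (Subgroup.zpowers g).index).codRestrict _ fun k ↦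
      (Subgroup.zpowers g).pow_index_mem k
  refine isCyclic_of_injective φ ((injective_iff_map_eq_one _).mpr fun k hk ↦ ?_)
  exact eq_one_of_pow_eq_one_of_torsionFree htf hg.index_ne_zero (congrArg Subtype.val hk)

theorem nonempty_mulEquiv_int [IsCyclic K] [Infinite K] : Nonempty (Multiplicative ℤ ≃* K) := by
  obtain ⟨c, hc⟩ := IsCyclic.exists_generator (α := K)
  have hcinf : ¬IsOfFinOrder c := by
    rw [← infinite_zpowers, (Subgroup.eq_top_iff' _).mpr hc]
    exact Set.infinite_univ
  refine ⟨MulEquiv.ofBijective (zpowersHom K c) ⟨fun m n hmn ↦ ?_, fun k ↦ ?_⟩⟩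
  · exact injective_zpow_iff_not_isOfFinOrder.mpr hcinf hmn
  · obtain ⟨n, hn⟩ := hc k
    exact ⟨Multiplicative.ofAdd n, hn⟩

end TorsionFree

/-! ### Commuting infinite subsets of hyperbolic groups -/

namespace IsHyperbolicGroup

variable {H : Type*} [Group H] {C : Set H} {A : Subgroup H}

theorem exists_isProperQuasimorphism (hH : IsHyperbolicGroup H) (hC : C.Infinite)
    (hA : A ≤ Subgroup.centralizer C) :
    ∃ (D : ℝ) (β : A → ℝ), IsProperQuasimorphism β D := by
  obtain ⟨S, hfin, hS, δ, hδ⟩ := hH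
  exact ⟨_, _root_.exists_isProperQuasimorphism hS hfin (fourPoint_of_gromovProduct hδ) hC hA⟩

theorem exists_mem_not_isOfFinOrder (hH : IsHyperbolicGroup H) (hC : C.Infinite)
    (hA : A ≤ Subgroup.centralizer C) (hinf : Infinite A) : ∃ g ∈ A, ¬IsOfFinOrder g := by
  obtain ⟨D, β, hβ⟩ := hH.exists_isProperQuasimorphism hC hA
  obtain ⟨g, hg⟩ := hβ.exists_not_isOfFinOrder
  exact ⟨g, g.2, fun h ↦ hg (Submonoid.isOfFinOrder_coe.mp h)⟩

theorem exists_finite_cover (hH : IsHyperbolicGroup H) (hC : C.Infinite)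
    (hA : A ≤ Subgroup.centralizer C) {g : H} (hgA : g ∈ A) (hg : ¬IsOfFinOrder g) :
    ∃ F : Set H, F.Finite ∧ ∀ a ∈ A, ∃ s ∈ F, s ∈ A ∧ s⁻¹ * a ∈ Subgroup.zpowers g := by
  obtain ⟨D, β, hβ⟩ := hH.exists_isProperQuasimorphism hC hA
  obtain ⟨F, hF, hcov⟩ := hβ.exists_finite (g := ⟨g, hgA⟩)
    fun h ↦ hg (Submonoid.isOfFinOrder_coe.mpr h)
  refine ⟨_, hF.image Subtype.val, fun a ha ↦ ?_⟩
  obtain ⟨s, hs, n, hn⟩ := hcov ⟨a, ha⟩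
  exact ⟨s, ⟨s, hs, rfl⟩, s.2, n, congrArg Subtype.val hn⟩

/-- If a subgroup `Δ` and its centralizer are both infinite, then `Δ` contains an element `g` of
infinite order, `⟨g⟩` has finite index in `Δ` and in the centralizer of `g`, and therefore in any
group covered by finitely many right cosets of `Δ * centralizer Δ`. -/
theorem exists_finiteIndex_zpowers (hH : IsHyperbolicGroup H) {Δ E : Subgroup H}
    (hΔ : Infinite Δ) (hC : (Subgroup.centralizer (Δ : Set H) : Set H).Infinite) {Y : Set H}
    (hY : Y.Finite)
    (hE : ∀ e ∈ E, ∃ t ∈ Δ, ∃ c ∈ Subgroup.centralizer (Δ : Set H), ∃ y ∈ Y, e = t * c * y) :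
    ∃ g ∈ Δ, ((Subgroup.zpowers g).subgroupOf E).FiniteIndex := by
  have hcomm {t c : H} (ht : t ∈ Δ) (hc : c ∈ Subgroup.centralizer (Δ : Set H)) :
      t * c = c * t := hc t ht
  have hΔC : Δ ≤ Subgroup.centralizer (Subgroup.centralizer (Δ : Set H) : Set H) :=
    fun t ht c hc ↦ (hcomm ht hc).symm
  obtain ⟨g, hgΔ, hg⟩ := hH.exists_mem_not_isOfFinOrder hC hΔC hΔ
  obtain ⟨F₁, hF₁, hcov₁⟩ := hH.exists_finite_cover hC hΔC hgΔ hg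
  obtain ⟨F₂, hF₂, hcov₂⟩ := hH.exists_finite_cover (infinite_zpowers.mpr hg) le_rfl
    (g := g) (by rintro _ ⟨n, rfl⟩; exact (Commute.refl g).zpow_left n) hg
  refine ⟨g, hgΔ, finiteIndex_subgroupOf_of_cover
    (F := Set.image2 (fun y p ↦ y⁻¹ * p) Y (Set.image2 (fun s r ↦ s * r) F₁ F₂))
    (hY.image2 _ (hF₁.image2 _ hF₂)) fun e he ↦ ?_⟩
  -- the inverse of `e` is the product `y⁻¹ * c⁻¹ * t⁻¹`, in which `c` commutes with `Δ`
  obtain ⟨t, ht, c, hc, y, hy, hey⟩ := hE e⁻¹ (inv_mem he)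
  obtain ⟨s, hs, hsΔ, hst⟩ := hcov₁ t⁻¹ (inv_mem ht)
  obtain ⟨r, hr, -, hrc⟩ := hcov₂ c⁻¹ (inv_mem (Subgroup.centralizer_le
    (Subgroup.zpowers_le.mpr hgΔ) hc))
  refine ⟨_, ⟨y, hy, _, ⟨s, hs, r, hr, rfl⟩, rfl⟩, ?_⟩
  have h1 : s⁻¹ * c⁻¹ = c⁻¹ * s⁻¹ := hcomm (inv_mem hsΔ) (inv_mem hc)
  have h2 : (y⁻¹ * (s * r))⁻¹ * e = r⁻¹ * c⁻¹ * (s⁻¹ * t⁻¹) := by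
    rw [← inv_inv e, hey, mul_assoc r⁻¹, ← mul_assoc c⁻¹, ← h1]
    group
  exact h2 ▸ mul_mem hrc hst

end IsHyperbolicGroup

/-! ### The defect group of a map between groups -/

section Defect

open scoped Pointwise

variable {G H : Type*} [Group G] [Group H]

/-- The failure of `f` to be multiplicative at `x` and `y`: `f x * f y = f (x * y) * defect f x y`. -/
def defect (f : G → H) (x y : G) : H := (f (x * y))⁻¹ * (f x * f y)

/-- The set of all defects of `f`. It is finite if `f` is a quasihomomorphism. -/
def defectSet (f : G → H) : Set H := Set.range fun p : G × G ↦ defect f p.1 p.2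

/-- The group generated by all defects of `f`. -/
def defectGroup (f : G → H) : Subgroup H := Subgroup.closure (defectSet f)

variable (f : G → H)

theorem defect_mem_defectSet (x y : G) : defect f x y ∈ defectSet f := ⟨(x, y), rfl⟩

theorem defect_mem_defectGroup (x y : G) : defect f x y ∈ defectGroup f :=
  Subgroup.subset_closure (defect_mem_defectSet f x y)

theorem map_mul_defect (x y : G) : f x * f y = f (x * y) * defect f x y := by
  simp [defect]

/-- The cocycle identity, which expresses that `f x * f y * f z` can be bracketed in two ways. -/
theorem conj_defect (x y z : G) : (f z)⁻¹ * defect f x y * f z =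
    (defect f (x * y) z)⁻¹ * defect f x (y * z) * defect f y z := by
  simp only [defect, mul_assoc x y z]
  group

theorem conj_mem_of_mem_defectSet {d : H} (hd : d ∈ defectSet f) (z : G) :
    (f z)⁻¹ * d * f z ∈ (defectSet f)⁻¹ * defectSet f * defectSet f := by
  obtain ⟨⟨x, y⟩, rfl⟩ := hd
  rw [conj_defect]
  exact Set.mul_mem_mul (Set.mul_mem_mul (Set.inv_mem_inv.mpr (defect_mem_defectSet f _ _))
    (defect_mem_defectSet f _ _)) (defect_mem_defectSet f _ _)

theorem map_one_mem_defectGroup : f 1 ∈ defectGroup f := by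
  have h := defect_mem_defectGroup f 1 1
  rwa [defect, mul_one, inv_mul_cancel_left] at h

theorem conj_inv_mem_defectGroup {t : H} (ht : t ∈ defectGroup f) (z : G) :
    (f z)⁻¹ * t * f z ∈ defectGroup f := by
  have hle : defectGroup f ≤ (defectGroup f).comap (MulAut.conj (f z)⁻¹).toMonoidHom := by
    refine (Subgroup.closure_le _).mpr ?_
    rintro _ ⟨⟨x, y⟩, rfl⟩
    have h : (f z)⁻¹ * defect f x y * f z ∈ defectGroup f := by
      rw [conj_defect]
      exact mul_mem (mul_mem (inv_mem (defect_mem_defectGroup f _ _))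
        (defect_mem_defectGroup f _ _)) (defect_mem_defectGroup f _ _)
    simpa using h
  simpa using hle ht

theorem conj_mem_defectGroup {t : H} (ht : t ∈ defectGroup f) (z : G) :
    f z * t * (f z)⁻¹ ∈ defectGroup f := by
  -- modulo the defect group, `f z` is the inverse of `f z⁻¹`
  have h1 := map_mul_defect f z⁻¹ z
  rw [inv_mul_cancel] at h1
  set d := f 1 * defect f z⁻¹ z
  have hd : d ∈ defectGroup f :=
    mul_mem (map_one_mem_defectGroup f) (defect_mem_defectGroup f _ _)
  have h2 : f z = (f z⁻¹)⁻¹ * d := by rw [← h1]; group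
  have h3 : f z * t * (f z)⁻¹ = (f z⁻¹)⁻¹ * (d * t * d⁻¹) * f z⁻¹ := by rw [h2]; group
  rw [h3]
  exact conj_inv_mem_defectGroup f (mul_mem (mul_mem hd ht) (inv_mem hd)) _

theorem map_mem_normalizer (z : G) : f z ∈ Subgroup.normalizer (defectGroup f : Set H) := by
  rw [Subgroup.mem_normalizer_iff]
  refine fun t ↦ ⟨fun ht ↦ conj_mem_defectGroup f ht z, fun ht ↦ ?_⟩
  have := conj_inv_mem_defectGroup f ht z
  rwa [show (f z)⁻¹ * (f z * t * (f z)⁻¹) * f z = t by group] at this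

/-- Every map becomes a homomorphism modulo its defect group. -/
def quotientHom : G →* Subgroup.normalizer (defectGroup f : Set H) ⧸
    (defectGroup f).subgroupOf (Subgroup.normalizer (defectGroup f : Set H)) :=
  MonoidHom.mk' (fun x ↦ QuotientGroup.mk ⟨f x, map_mem_normalizer f x⟩) fun x y ↦ by
    rw [← QuotientGroup.mk_mul, QuotientGroup.eq, Subgroup.mem_subgroupOf]
    exact defect_mem_defectGroup f x y

theorem isAlmostHomomorphism_of_finite (h : Finite (defectGroup f)) : IsAlmostHomomorphism f := by
  refine ⟨_, _, inferInstance, map_mem_normalizer f, quotientHom f, ?_, fun x ↦ rfl⟩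
  refine Finite.of_injective (β := defectGroup f) (fun k ↦ ⟨k, k.2⟩) fun a b hab ↦ ?_
  exact Subtype.ext (Subtype.ext (congrArg (fun t : defectGroup f ↦ (t : H)) hab))

/-- The preimage of the image of `f` modulo its defect group. -/
def imageGroup : Subgroup H :=
  ((quotientHom f).range.comap (QuotientGroup.mk' _)).map (Subgroup.subtype _)

theorem map_mem_imageGroup (x : G) : f x ∈ imageGroup f :=
  ⟨⟨f x, map_mem_normalizer f x⟩, ⟨x, rfl⟩, rfl⟩

theorem exists_eq_mul_of_mem_imageGroup {j : H} (hj : j ∈ imageGroup f) :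
    ∃ t ∈ defectGroup f, ∃ x, j = t * f x := by
  obtain ⟨j, ⟨x, hx⟩, rfl⟩ := hj
  have hx : QuotientGroup.mk ⟨f x, map_mem_normalizer f x⟩ = QuotientGroup.mk j := hx
  rw [QuotientGroup.eq, Subgroup.mem_subgroupOf] at hx
  refine ⟨_, conj_mem_defectGroup f hx x, x, ?_⟩
  simp

theorem defectGroup_le_imageGroup : defectGroup f ≤ imageGroup f := by
  refine (Subgroup.closure_le _).mpr ?_
  rintro _ ⟨⟨x, y⟩, rfl⟩
  exact mul_mem (inv_mem (map_mem_imageGroup f _))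
    (mul_mem (map_mem_imageGroup f _) (map_mem_imageGroup f _))

/-- As `f x` conjugates the finitely many defects into a finite set, the values of `f` lie in
finitely many right cosets of the centralizer of the defects. -/
theorem exists_finite_right_cosets (hfin : (defectSet f).Finite) :
    ∃ Y : Set H, Y.Finite ∧
      ∀ x, ∃ y ∈ Y, f x * y⁻¹ ∈ Subgroup.centralizer (defectGroup f : Set H) := by
  let Φ : G → defectSet f → H := fun x d ↦ (f x)⁻¹ * d * f x
  have := hfin.to_subtype
  have hΦ : (Set.range Φ).Finite := by
    refine (Set.Finite.pi' fun _ : defectSet f ↦ (hfin.inv.mul hfin).mul hfin).subset ?_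
    rintro _ ⟨x, rfl⟩ d
    exact conj_mem_of_mem_defectSet f d.2 x
  have := hΦ.to_subtype
  refine ⟨Set.range fun u ↦ f (Set.rangeSplitting Φ u), Set.finite_range _,
    fun x ↦ ⟨_, ⟨⟨Φ x, x, rfl⟩, rfl⟩, ?_⟩⟩
  set y := Set.rangeSplitting Φ ⟨Φ x, x, rfl⟩
  have hy : Φ y = Φ x := Set.apply_rangeSplitting Φ _
  rw [defectGroup, Subgroup.centralizer_closure]
  intro d hd
  have hd : (f y)⁻¹ * d * f y = (f x)⁻¹ * d * f x := congrFun hy ⟨d, hd⟩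
  calc d * (f x * (f y)⁻¹) = f x * ((f x)⁻¹ * d * f x) * (f y)⁻¹ := by group
    _ = f x * (f y)⁻¹ * d := by rw [← hd]; group

theorem infinite_centralizer_defectGroup (hfin : (defectSet f).Finite)
    (hinf : (Set.range f).Infinite) :
    (Subgroup.centralizer (defectGroup f : Set H) : Set H).Infinite := by
  obtain ⟨Y, hY, hcov⟩ := exists_finite_right_cosets f hfin
  refine fun hC ↦ hinf ((hC.mul hY).subset ?_)
  rintro _ ⟨x, rfl⟩
  obtain ⟨y, hy, hxy⟩ := hcov x
  exact ⟨_, hxy, y, hy, by simp⟩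

theorem exists_finiteIndex_zpowers_imageGroup (hH : IsHyperbolicGroup H)
    (hfin : (defectSet f).Finite) (hinf : (Set.range f).Infinite)
    (hΔ : Infinite (defectGroup f)) :
    ∃ g ∈ imageGroup f, ((Subgroup.zpowers g).subgroupOf (imageGroup f)).FiniteIndex := by
  obtain ⟨Y, hY, hcov⟩ := exists_finite_right_cosets f hfin
  obtain ⟨g, hg, hfi⟩ := hH.exists_finiteIndex_zpowers hΔ
    (infinite_centralizer_defectGroup f hfin hinf) hY (E := imageGroup f) fun e he ↦ by
      obtain ⟨t, ht, x, rfl⟩ := exists_eq_mul_of_mem_imageGroup f he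
      obtain ⟨y, hy, hxy⟩ := hcov x
      exact ⟨t, ht, _, hxy, y, hy, by group⟩
  exact ⟨g, defectGroup_le_imageGroup f hg, hfi⟩

theorem IsQuasihomomorphism.finite_defectSet [MetricSpace H] [DiscreteTopology H] [ProperSpace H]
    [IsIsometricSMul H H] (hf : IsQuasihomomorphism f) : (defectSet f).Finite := by
  obtain ⟨C, hC⟩ := hf
  refine (isCompact_iff_finite.mp (isCompact_closedBall (1 : H) C)).subset ?_
  rintro _ ⟨⟨x, y⟩, rfl⟩
  rw [Metric.mem_closedBall, dist_comm]
  calc dist 1 (defect f x y)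
      = dist (f (x * y) • (1 : H)) (f (x * y) • defect f x y) := (dist_smul _ _ _).symm
    _ ≤ C := by simpa [← map_mul_defect] using hC x y

end Defect

theorem isQuasimorphism_of_finite_defectSet {G H : Type*} [Group G] [Group H] {f : G → H}
    (hfin : (defectSet f).Finite) {C : Subgroup H} (e : Multiplicative ℤ ≃* C) {q : G → ℤ}
    (hq : ∀ x, f x = (e (Multiplicative.ofAdd (q x)) : H)) : IsQuasimorphism q := by
  have hinj : Function.Injective fun n : ℤ ↦ (e (Multiplicative.ofAdd n) : H) :=
    Subtype.val_injective.comp (e.injective.comp Multiplicative.ofAdd.injective)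
  obtain ⟨B, hB⟩ := (hfin.preimage hinj.injOn).isBounded.subset_closedBall 0
  refine ⟨B, fun x y ↦ ?_⟩
  have hmem : q x + q y - q (x * y) ∈
      (fun n : ℤ ↦ (e (Multiplicative.ofAdd n) : H)) ⁻¹' defectSet f := by
    refine ⟨(x, y), ?_⟩
    have h : q x + q y - q (x * y) = -q (x * y) + (q x + q y) := by ring
    simp [defect, hq, h, ofAdd_add, ofAdd_neg]
  have := hB hmem
  rwa [Metric.mem_closedBall, dist_zero_right, ← dist_eq_norm, dist_comm] at this

/-! ### Quasihomomorphisms to hyperbolic groups -/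

/-- `H` is discrete and carries an arbitrary proper left-invariant metric. -/
theorem mainTheorem2 {G H : Type*} [Group G] [Group H]
    [MetricSpace H] [DiscreteTopology H] [ProperSpace H] [IsIsometricSMul H H]
    (hH : IsHyperbolicGroup H)
    (f : G → H) (hf : IsQuasihomomorphism f) (hub : ¬ Bornology.IsBounded (Set.range f)) :
    ((∀ h : H, IsOfFinOrder h → h = 1) →
      (∃ φ : G →* H, ∀ x, f x = φ x) ∨
      (∃ (C : Subgroup H) (e : Multiplicative ℤ ≃* C) (q : G → ℤ),
        IsQuasimorphism q ∧ ∀ x, f x = (e (Multiplicative.ofAdd (q x)) : H))) ∧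
    ((∃ E : Subgroup H, IsElementarySubgroup E ∧ ∀ x, f x ∈ E) ∨ IsAlmostHomomorphism f) := by
  have hfin := hf.finite_defectSet
  have hinf : (Set.range f).Infinite := fun h ↦ hub h.isBounded
  rcases finite_or_infinite (defectGroup f) with hΔ | hΔ
  · refine ⟨fun htf ↦ Or.inl ?_, Or.inr (isAlmostHomomorphism_of_finite f hΔ)⟩
    refine ⟨MonoidHom.mk' f fun x y ↦ ?_, fun x ↦ rfl⟩
    have h1 : defect f x y = 1 := htf _ (Submonoid.isOfFinOrder_coe.mpr
      (isOfFinOrder_of_finite (⟨_, defect_mem_defectGroup f x y⟩ : defectGroup f)))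
    rw [map_mul_defect, h1, mul_one]
  · obtain ⟨g, hg, hfi⟩ := exists_finiteIndex_zpowers_imageGroup f hH hfin hinf hΔ
    have hsub : (Subgroup.zpowers g).subgroupOf (imageGroup f) =
        Subgroup.zpowers (⟨g, hg⟩ : imageGroup f) := by
      ext k
      simp [Subgroup.mem_subgroupOf, Subgroup.mem_zpowers_iff, Subtype.ext_iff]
    rw [hsub] at hfi
    refine ⟨fun htf ↦ Or.inr ?_, Or.inl ⟨imageGroup f, ⟨_, inferInstance, hfi⟩,
      map_mem_imageGroup f⟩⟩
    have : IsCyclic (imageGroup f) := isCyclic_of_finiteIndex_zpowers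
      (fun k hk ↦ Subtype.ext (htf k (Submonoid.isOfFinOrder_coe.mpr hk))) hfi
    have : Infinite (imageGroup f) :=
      Set.infinite_coe_iff.mpr (hinf.mono (Set.range_subset_iff.mpr (map_mem_imageGroup f)))
    obtain ⟨e⟩ := nonempty_mulEquiv_int (K := imageGroup f)
    have hq (x : G) : f x = (e (Multiplicative.ofAdd
        (e.symm ⟨f x, map_mem_imageGroup f x⟩).toAdd) : H) := by simp
    exact ⟨imageGroup f, e, _, isQuasimorphism_of_finite_defectSet hfin e hq, hq⟩
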